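/- For $n\ge 2$ let $\mathcal A_n=\{0,\dots,n-1\}$ and let $\mathfrak C_n=\mathcal A_n^{\mathbb N}$ be the Cantor space of infinite words, with the product topology. A finite set $P\subset\mathcal A_n^*$ of finite words is a (complete) prefix code if every $\zeta\in\mathfrak C_n$ has exactly one element of $P$ as a prefix. A permutation $\sigma\in\operatorname{Sym}(n)$ acts on words letter by letter. For $H\le\operatorname{Sym}(n)$, the symmetric Thompson group $V_n(H)$ is the group, under composition, of all homeomorphisms $v$ of $\mathfrak C_n$ for which there are prefix codes $\{p_1,\dots,p_l\}$ and $\{q_1,\dots,q_l\}$ (each with $l$ distinct elements) and $\sigma_i,\tau_i\in H$ such that $v(p_i\,\sigma_i(u))=q_i\,\tau_i(u)$ for all $i$ and all $u\in\mathfrak C_n$. **Theorem.** Let $m\ge 2$ and $k\ge 1$ be natural numbers, let $n=k(m-1)+m$, and let $G\le\operatorname{Sym}(m)$. Let $H=G_{ext}\le\operatorname{Sym}(n)$ be the group of those permutations of $\mathcal A_n$ that act on the first $m$ letters $0,\dots,m-1$ as some element of $G$ and fix the remaining $n-m$ letters. Then $V_m(G)$ embeds in $V_n(H)$: there is an injective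 group homomorphism $\varphi:V_m(G)\to V_n(H)$. Moreover, $\varphi$ can be chosen not to arise from a topological conjugacy, that is, so that there is no homeomorphism $h:\mathfrak C_m\to\mathfrak C_n$ with $\varphi(g)=h\circ g\circ h^{-1}$ for all $g\in V_m(G)$. -/

import Mathlib

namespace SymThompson

/-- The alphabet `{0, …, n-1}`. -/
abbrev Letter (n : ℕ) : Type := Fin n

/-- Finite words, including the empty word. -/
abbrev Word (n : ℕ) : Type := List (Letter n)

/-- The `n`-adic Cantor space: infinite words, with the product topology (letters are discrete). -/
abbrev Cantor (n : ℕ) : Type := ℕ → Letter n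

/-- Concatenation of a finite word with an infinite word. -/
def cat {n : ℕ} : Word n → Cantor n → Cantor n
  | [], u => u
  | a :: w, u => fun i => Nat.casesOn i a (cat w u)

/-- `p` is a prefix of the infinite word `ζ`. -/
def IsPrefixOf {n : ℕ} (p : Word n) (ζ : Cantor n) : Prop :=
  ∃ u : Cantor n, ζ = cat p u

/-- The finite list of words `p` enumerates, without repetition, a (complete) prefix code:
every infinite word has exactly one of them as a prefix. -/
def IsPrefixCode {n l : ℕ} (p : Fin l → Word n) : Prop :=
  ∀ ζ : Cantor n, ∃! i : Fin l, IsPrefixOf (p i) ζ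

/-- A table with four rows `p, σ, q, τ`; the rows `p` and `q` are prefix codes, and the
permutations `σ i`, `τ i` belong to `H`. -/
structure Table (n : ℕ) (H : Subgroup (Equiv.Perm (Letter n))) where
  len : ℕ
  p : Fin len → Word n
  σ : Fin len → Equiv.Perm (Letter n)
  q : Fin len → Word n
  τ : Fin len → Equiv.Perm (Letter n)
  code_p : IsPrefixCode p
  code_q : IsPrefixCode q
  σ_mem : ∀ i, σ i ∈ H
  τ_mem : ∀ i, τ i ∈ H

/-- The table `T` describes the homeomorphism `f`: `p i ‖ σ i (u) ↦ q i ‖ τ i (u)` for every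
column `i` and every infinite word `u`, where a permutation acts letter by letter. -/
def Table.Describes {n : ℕ} {H : Subgroup (Equiv.Perm (Letter n))} (T : Table n H)
    (f : Cantor n ≃ₜ Cantor n) : Prop :=
  ∀ (i : Fin T.len) (u : Cantor n), f (cat (T.p i) (T.σ i ∘ u)) = cat (T.q i) (T.τ i ∘ u)

section Closure

variable {n : ℕ} {H : Subgroup (Equiv.Perm (Letter n))}

theorem cat_append (v w : Word n) (u : Cantor n) : cat (v ++ w) u = cat v (cat w u) := by
  induction v with
  | nil => rfl
  | cons a v ih => simp only [List.cons_append, cat, ih]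

theorem comp_cat (τ : Equiv.Perm (Letter n)) (w : Word n) (u : Cantor n) :
    τ ∘ cat w u = cat (w.map τ) (τ ∘ u) := by
  induction w with
  | nil => rfl
  | cons a w ih =>
    funext i
    cases i with
    | zero => rfl
    | succ i => exact congrFun ih i

theorem cat_cons_inj {a b : Letter n} {v w : Word n} {u z : Cantor n}
    (h : cat (a :: v) u = cat (b :: w) z) : a = b ∧ cat v u = cat w z :=
  ⟨congrFun h 0, funext fun i => congrFun h (i + 1)⟩

theorem prefix_of_cat_eq {v w : Word n} {u z : Cantor n} (h : cat v u = cat w z)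
    (hl : v.length ≤ w.length) : ∃ t, w = v ++ t := by
  induction v generalizing w with
  | nil => exact ⟨w, rfl⟩
  | cons a v ih =>
    cases w with
    | nil => simp at hl
    | cons b w =>
      obtain ⟨rfl, h'⟩ := cat_cons_inj h
      obtain ⟨t, rfl⟩ := ih h' (by simpa using hl)
      exact ⟨t, rfl⟩

theorem exists_cat (N : ℕ) (ζ : Cantor n) : ∃ w : Word n, w.length = N ∧ ∃ u, ζ = cat w u := by
  induction N generalizing ζ with
  | zero => exact ⟨[], rfl, ζ, rfl⟩
  | succ N ih =>
    obtain ⟨w, hw, u, hu⟩ := ih fun i => ζ (i + 1)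
    refine ⟨ζ 0 :: w, by simp [hw], u, funext fun i => ?_⟩
    cases i with
    | zero => rfl
    | succ i => exact congrFun hu i

theorem describes_iff (f : Cantor n ≃ₜ Cantor n) :
    (∃ T : Table n H, T.Describes f) ↔
      ∃ N : ℕ, ∀ w : Word n, w.length = N →
        ∃ q : Word n, ∃ τ ∈ H, ∀ u, f (cat w u) = cat q (τ ∘ u) := by
  constructor
  · rintro ⟨T, hT⟩
    refine ⟨∑ i, (T.p i).length, fun w hw => ?_⟩
    by_cases hne : Nonempty (Cantor n)
    · obtain ⟨u₀⟩ := hne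
      obtain ⟨i, ⟨z, hz⟩, -⟩ := T.code_p (cat w u₀)
      have hle : (T.p i).length ≤ w.length := by
        rw [hw]
        exact Finset.single_le_sum (f := fun i => (T.p i).length) (fun _ _ => Nat.zero_le _)
          (Finset.mem_univ i)
      obtain ⟨t, rfl⟩ := prefix_of_cat_eq hz.symm hle
      refine ⟨T.q i ++ t.map (T.τ i * (T.σ i)⁻¹), T.τ i * (T.σ i)⁻¹,
        H.mul_mem (T.τ_mem i) (H.inv_mem (T.σ_mem i)), fun u => ?_⟩
      have h := hT i (⇑(T.σ i)⁻¹ ∘ cat t u)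
      have e : T.σ i ∘ (⇑(T.σ i)⁻¹ ∘ cat t u) = cat t u := by
        funext j; simp
      rw [e] at h
      rw [cat_append, h, cat_append, ← comp_cat]
      rfl
    · exact ⟨[], 1, H.one_mem, fun u => (hne ⟨u⟩).elim⟩
  · rintro ⟨N, hN⟩
    let e := Fintype.equivFin (List.Vector (Letter n) N)
    choose q τ hτ hf using fun w : List.Vector (Letter n) N => hN w.1 w.2
    have hcode : ∀ ζ : Cantor n, ∃ w : List.Vector (Letter n) N, IsPrefixOf w.1 ζ ∧
        ∀ v : List.Vector (Letter n) N, IsPrefixOf v.1 ζ → v = w := by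
      intro ζ
      obtain ⟨w, hw, u, hu⟩ := exists_cat N ζ
      refine ⟨⟨w, hw⟩, ⟨u, hu⟩, ?_⟩
      rintro ⟨v, hv⟩ ⟨z, hz⟩
      obtain ⟨t, ht⟩ := prefix_of_cat_eq (hz.symm.trans hu) (by simp [hv, hw])
      apply Subtype.ext
      have : t = [] := by
        have := congrArg List.length ht
        simp [hv, hw] at this
        exact this
      simp [ht, this]
    refine ⟨{ len := _, p := fun i => (e.symm i).1, σ := fun _ => 1, q := fun i => q (e.symm i),
              τ := fun i => τ (e.symm i), code_p := ?_, code_q := ?_,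
              σ_mem := fun _ => H.one_mem, τ_mem := fun i => hτ _ }, ?_⟩
    · intro ζ
      obtain ⟨w, hw, huniq⟩ := hcode ζ
      refine ⟨e w, by simpa using hw, fun i hi => ?_⟩
      rw [← huniq _ hi, Equiv.apply_symm_apply]
    · intro ζ
      obtain ⟨w, ⟨u, hu⟩, huniq⟩ := hcode (f.symm ζ)
      refine ⟨e w, ⟨τ w ∘ u, ?_⟩, ?_⟩
      · simp only [Equiv.symm_apply_apply]
        rw [← hf, ← hu, Homeomorph.apply_symm_apply]
      · rintro i ⟨z, hz⟩
        have : e.symm i = w := by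
          apply huniq
          refine ⟨⇑(τ (e.symm i))⁻¹ ∘ z, ?_⟩
          rw [Homeomorph.symm_apply_eq, hf, hz]
          congr 1
          funext j; simp
        rw [← this, Equiv.apply_symm_apply]
    · intro i u
      exact hf (e.symm i) u

end Closure

/-- The symmetric Thompson group `V_n(H)`: all homeomorphisms of the Cantor space that are
described by some table, under composition. -/
def V (n : ℕ) (H : Subgroup (Equiv.Perm (Letter n))) : Subgroup (Cantor n ≃ₜ Cantor n) where
  carrier := {f | ∃ T : Table n H, T.Describes f}
  one_mem' := by
    rw [Set.mem_ofPred_eq, describes_iff]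
    exact ⟨0, fun w _ => ⟨w, 1, H.one_mem, fun u => rfl⟩⟩
  mul_mem' := by
    intro g f hg hf
    rw [Set.mem_ofPred_eq, describes_iff] at hg hf ⊢
    obtain ⟨N₂, hg⟩ := hg
    obtain ⟨N₁, hf⟩ := hf
    refine ⟨N₁ + N₂, fun w hw => ?_⟩
    obtain ⟨q, τ, hτ, hq⟩ := hf (w.take N₁) (by simp [hw])
    have hlen : N₂ ≤ (q ++ (w.drop N₁).map τ).length := by simp [hw]
    obtain ⟨q', τ', hτ', hq'⟩ := hg ((q ++ (w.drop N₁).map τ).take N₂) (by simp [hw])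
    refine ⟨q' ++ ((q ++ (w.drop N₁).map τ).drop N₂).map τ', τ' * τ, H.mul_mem hτ' hτ,
      fun u => ?_⟩
    have h1 : f (cat w u) = cat (q ++ (w.drop N₁).map τ) (τ ∘ u) := by
      conv_lhs => rw [← List.take_append_drop N₁ w]
      rw [cat_append, hq, comp_cat, cat_append]
    rw [Homeomorph.mul_apply, h1]
    conv_lhs => rw [← List.take_append_drop N₂ (q ++ (w.drop N₁).map τ)]
    rw [cat_append, hq', comp_cat, cat_append]
    rfl
  inv_mem' := by
    rintro f ⟨T, hT⟩
    refine ⟨⟨T.len, T.q, T.τ, T.p, T.σ, T.code_q, T.code_p, T.τ_mem, T.σ_mem⟩, fun i u => ?_⟩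
    change f.symm _ = _
    rw [Homeomorph.symm_apply_eq]
    exact (hT i u).symm

/-- The extended group `G_ext ≤ Sym(n)` of `G ≤ Sym(m)`, for `m ≤ n`: each element of `G` acts on
the first `m` letters as it does in `Sym(m)`, and fixes the remaining `n - m` letters. -/
noncomputable def extGroup {m n : ℕ} (hmn : m ≤ n) (G : Subgroup (Equiv.Perm (Letter m))) :
    Subgroup (Equiv.Perm (Letter n)) :=
  G.map (Equiv.Perm.viaEmbeddingHom (Fin.castLEEmb hmn))

end SymThompson

namespace SymThompson

/-! An element of V_m(G) is locally w u ↦ q τ(u). Such a rule makes sense on any set X that splits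
into m copies of itself compatibly with Sym(m), so V_m(G) acts on every such X (`liftHom`),
faithfully if X is nonempty (`liftHom_injective`).

It remains to find such an X inside the n-adic Cantor space, with copies cut out by prefix
replacements. Take the words c y ... with c < m and y not the last letter. The branch to c must
carry X onto the words of X starting with c. Words c y ... with y = c or y ≥ m stay fixed. For y <
m, y ≠ c, the words c y z ... with z not last come from y z ... by prepending c, and the words c y
last ... come from c y ... by inserting the last letter. Extended permutations fix the last letter
and preserve the case distinction, so they commute with this recipe (`map_branchWord`). Hence the
action is by prefix replacement with tails permuted by G_ext (`cantorHom_locallyActs`).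

Extended by the identity off X, the action fixes the constant word in the last letter, while V_m(G)
has no global fixed point. This rules out a conjugacy. -/

/-- `f` maps the cone of `w` to the cone of `q`, acting on the tails through `τ`. -/
def LocallyActs {m : ℕ} (f : Cantor m → Cantor m) (w q : Word m)
    (τ : Equiv.Perm (Letter m)) : Prop :=
  ∀ u, f (cat w u) = cat q (τ ∘ u)

/-! ### Local descriptions of maps of the Cantor space. -/

section Local

variable {m : ℕ}

theorem cat_injective (w : Word m) : Function.Injective (cat w) := by
  induction w with
  | nil => exact fun _ _ h => h
  | cons a w ih => exact fun _ _ h => ih (cat_cons_inj h).2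

theorem LocallyActs.append {f : Cantor m → Cantor m} {w q : Word m} {τ : Equiv.Perm (Letter m)}
    (h : LocallyActs f w q τ) (t : Word m) : LocallyActs f (w ++ t) (q ++ t.map τ) τ := by
  intro u
  rw [cat_append, h, comp_cat, cat_append]

theorem LocallyActs.comp {f g : Cantor m → Cantor m} {w q r : Word m}
    {τ σ : Equiv.Perm (Letter m)} (hf : LocallyActs f w q τ) (hg : LocallyActs g q r σ) :
    LocallyActs (g ∘ f) w r (σ * τ) := by
  intro u
  rw [Function.comp_apply, hf, hg]
  rfl

/-- If `r` were strictly longer than `q`, the first letter of `τ ∘ u` would be the same for all `u`,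
which is impossible with two letters. -/
theorem eq_of_cat_comp_eq_of_le (hm : 2 ≤ m) {q r : Word m} {τ σ : Equiv.Perm (Letter m)}
    (hl : q.length ≤ r.length) (h : ∀ u, cat q (τ ∘ u) = cat r (σ ∘ u)) : q = r ∧ τ = σ := by
  have : Nontrivial (Letter m) := Fin.nontrivial_iff_two_le.2 hm
  obtain ⟨a₀⟩ := (inferInstance : Nonempty (Letter m))
  obtain ⟨t, rfl⟩ := prefix_of_cat_eq (h fun _ => a₀) hl
  have h' : ∀ u, τ ∘ u = cat t (σ ∘ u) := fun u =>
    cat_injective q (by rw [h, cat_append])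
  cases t with
  | nil =>
    refine ⟨by simp, Equiv.ext fun a => ?_⟩
    exact congrFun (h' fun _ => a) 0
  | cons a t =>
    obtain ⟨b, hb⟩ := exists_ne (τ.symm a)
    have : τ b = a := congrFun (h' fun _ => b) 0
    exact absurd (by rw [← this, Equiv.symm_apply_apply]) hb

theorem LocallyActs.unique (hm : 2 ≤ m) {f : Cantor m → Cantor m} {w q r : Word m}
    {τ σ : Equiv.Perm (Letter m)} (h : LocallyActs f w q τ) (h' : LocallyActs f w r σ) :
    q = r ∧ τ = σ := by
  have e : ∀ u, cat q (τ ∘ u) = cat r (σ ∘ u) := fun u => (h u).symm.trans (h' u)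
  rcases le_total q.length r.length with hl | hl
  · exact eq_of_cat_comp_eq_of_le hm hl e
  · obtain ⟨h₁, h₂⟩ := eq_of_cat_comp_eq_of_le hm hl fun u => (e u).symm
    exact ⟨h₁.symm, h₂.symm⟩

variable {G : Subgroup (Equiv.Perm (Letter m))}

theorem exists_locallyActs (f : V m G) : ∃ N : ℕ, ∀ w : Word m, w.length = N →
    ∃ q, ∃ τ ∈ G, LocallyActs (f : Cantor m ≃ₜ Cantor m) w q τ :=
  (describes_iff _).1 f.2

/-- The length bound makes the image prefix of a long word long enough for a second element to act
on it, as composition needs. -/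
theorem exists_locallyActs_of_le (f : V m G) : ∃ N : ℕ, ∀ w : Word m, N ≤ w.length →
    ∃ q, ∃ τ ∈ G, LocallyActs (f : Cantor m ≃ₜ Cantor m) w q τ ∧ w.length ≤ q.length + N := by
  obtain ⟨N, hN⟩ := exists_locallyActs f
  refine ⟨N, fun w hw => ?_⟩
  obtain ⟨q, τ, hτ, h⟩ := hN (w.take N) (by simpa using hw)
  refine ⟨q ++ (w.drop N).map τ, τ, hτ, ?_, by simp; omega⟩
  simpa using h.append (w.drop N)

/-- A map that is locally of the form `w u ↦ q τ(u)` is continuous. -/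
theorem continuous_of_locallyActs {f : Cantor m → Cantor m} {N : ℕ}
    (h : ∀ w : Word m, w.length = N → ∃ q τ, LocallyActs f w q τ) : Continuous f := by
  have hcat : ∀ q : Word m, Continuous (cat q) := by
    intro q
    induction q with
    | nil => exact continuous_id
    | cons a q ih =>
      refine continuous_pi fun i => ?_
      cases i with
      | zero => exact continuous_const
      | succ i => exact (continuous_apply i).comp ih
  have hagree : ∀ (w : Word m) (u ξ : Cantor m), (∀ i < w.length, ξ i = cat w u i) →
      ξ = cat w fun i => ξ (i + w.length) := by
    intro w
    induction w with
    | nil => exact fun _ _ _ => rfl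
    | cons a w ih =>
      intro u ξ hξ
      funext i
      cases i with
      | zero => exact hξ 0 (by simp)
      | succ i =>
        have := congrFun (ih u (fun i => ξ (i + 1)) fun i hi => hξ (i + 1) (by simpa using hi)) i
        simpa [cat, add_right_comm, add_assoc] using this
  rw [continuous_iff_continuousAt]
  intro ζ
  obtain ⟨w, hw, u, rfl⟩ := exists_cat N ζ
  obtain ⟨q, τ, hf⟩ := h w hw
  -- On the cylinder of `w`, `f` drops `w.length` letters, applies `τ` and prepends `q`.
  have hc : Continuous fun ξ : Cantor m => cat q (τ ∘ fun i => ξ (i + w.length)) :=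
    (hcat q).comp (continuous_pi fun i =>
      (continuous_of_discreteTopology (f := τ)).comp (continuous_apply (i + w.length)))
  refine hc.continuousAt.congr ?_
  have hev : ∀ᶠ ξ in nhds (cat w u), ∀ i ∈ Finset.range w.length, ξ i = cat w u i := by
    rw [Filter.eventually_all_finset]
    intro i _
    exact (continuous_apply i).continuousAt.eventually
      (show ∀ᶠ a in nhds (cat w u i), a = cat w u i by simp [nhds_discrete])
  filter_upwards [hev] with ξ hξ
  conv_rhs => rw [hagree w u ξ fun i hi => hξ i (Finset.mem_range.2 hi)]
  exact (hf _).symm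

end Local

/-! ### The action of V_m(G) on a self-similar set. -/

/-- A set `X` that is the disjoint union of copies of itself, one for each letter,
together with an action of `Sym(m)` that permutes these copies and acts inside each of them as it
does on `X`. -/
structure SelfSimilar (m : ℕ) (X : Type*) where
  branch : Letter m → X → X
  act : Equiv.Perm (Letter m) →* Equiv.Perm X
  bijective_branch : Function.Bijective fun p : Letter m × X => branch p.1 p.2
  act_branch : ∀ τ c x, act τ (branch c x) = branch (τ c) (act τ x)

namespace SelfSimilar

variable {m : ℕ} {X : Type*} (S : SelfSimilar m X)

/-- The copy of `X` inside `X` indexed by a finite word. -/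
def cone (w : Word m) (x : X) : X := w.foldr S.branch x

@[simp] theorem cone_nil (x : X) : S.cone [] x = x := rfl

@[simp] theorem cone_cons (c : Letter m) (w : Word m) (x : X) :
    S.cone (c :: w) x = S.branch c (S.cone w x) := rfl

theorem cone_append (v w : Word m) (x : X) : S.cone (v ++ w) x = S.cone v (S.cone w x) := by
  simp [cone]

theorem act_cone (τ : Equiv.Perm (Letter m)) (w : Word m) (x : X) :
    S.act τ (S.cone w x) = S.cone (w.map τ) (S.act τ x) := by
  induction w with
  | nil => rfl
  | cons c w ih => simp [act_branch, ih]

theorem branch_inj {c d : Letter m} {x y : X} (h : S.branch c x = S.branch d y) :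
    c = d ∧ x = y :=
  Prod.ext_iff.1 (S.bijective_branch.1 (a₁ := (c, x)) (a₂ := (d, y)) h)

theorem cone_injective (w : Word m) : Function.Injective (S.cone w) := by
  induction w with
  | nil => exact fun _ _ h => h
  | cons c w ih => exact fun _ _ h => ih (S.branch_inj h).2

theorem exists_cone (N : ℕ) (x : X) : ∃ w : Word m, w.length = N ∧ ∃ y, x = S.cone w y := by
  induction N generalizing x with
  | zero => exact ⟨[], rfl, x, rfl⟩
  | succ N ih =>
    obtain ⟨⟨c, x'⟩, rfl⟩ := S.bijective_branch.2 x
    obtain ⟨w, hw, y, rfl⟩ := ih x'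
    exact ⟨c :: w, by simp [hw], y, rfl⟩

theorem prefix_of_cone_eq {v w : Word m} {x y : X} (h : S.cone v x = S.cone w y)
    (hl : v.length ≤ w.length) : ∃ t, w = v ++ t := by
  induction v generalizing w with
  | nil => exact ⟨w, rfl⟩
  | cons a v ih =>
    cases w with
    | nil => simp at hl
    | cons b w =>
      obtain ⟨rfl, h'⟩ := S.branch_inj h
      obtain ⟨t, rfl⟩ := ih h' (by simpa using hl)
      exact ⟨t, rfl⟩

variable {G : Subgroup (Equiv.Perm (Letter m))}

/-- Two cones containing `x` have comparable words. Refining the shorter description by the missing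
letters `t` gives the longer one, by `LocallyActs.unique`, so the value does not depend on the
description. -/
theorem exists_lift (hm : 2 ≤ m) (f : V m G) (x : X) : ∃ y, ∀ w q τ z,
    LocallyActs (f : Cantor m ≃ₜ Cantor m) w q τ → x = S.cone w z → y = S.cone q (S.act τ z) := by
  obtain ⟨N, hN⟩ := exists_locallyActs f
  obtain ⟨w₀, hw₀, z₀, rfl⟩ := S.exists_cone N x
  obtain ⟨q₀, τ₀, -, h₀⟩ := hN w₀ hw₀
  refine ⟨S.cone q₀ (S.act τ₀ z₀), fun w q τ z h hx => ?_⟩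
  rcases le_total w₀.length w.length with hl | hl
  · obtain ⟨t, rfl⟩ := S.prefix_of_cone_eq hx hl
    rw [cone_append] at hx
    obtain rfl := S.cone_injective _ hx
    obtain ⟨rfl, rfl⟩ := (h₀.append t).unique hm h
    rw [act_cone, cone_append]
  · obtain ⟨t, rfl⟩ := S.prefix_of_cone_eq hx.symm hl
    rw [cone_append] at hx
    obtain rfl := S.cone_injective _ hx
    obtain ⟨rfl, rfl⟩ := (h.append t).unique hm h₀
    rw [act_cone, cone_append]

/-- The map of `X` induced by an element of `V_m(G)`. -/
noncomputable def lift (hm : 2 ≤ m) (f : V m G) (x : X) : X := (S.exists_lift hm f x).choose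

theorem lift_cone (hm : 2 ≤ m) {f : V m G} {w q : Word m} {τ : Equiv.Perm (Letter m)}
    (h : LocallyActs (f : Cantor m ≃ₜ Cantor m) w q τ) (x : X) :
    S.lift hm f (S.cone w x) = S.cone q (S.act τ x) :=
  (S.exists_lift hm f (S.cone w x)).choose_spec w q τ x h rfl

theorem lift_one (hm : 2 ≤ m) (x : X) : S.lift hm (1 : V m G) x = x := by
  have h : LocallyActs ((1 : V m G) : Cantor m ≃ₜ Cantor m) [] [] 1 := fun _ => rfl
  simpa using S.lift_cone hm h x

theorem lift_mul (hm : 2 ≤ m) (g f : V m G) (x : X) :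
    S.lift hm (g * f) x = S.lift hm g (S.lift hm f x) := by
  obtain ⟨N₁, hf⟩ := exists_locallyActs_of_le f
  obtain ⟨N₂, hg⟩ := exists_locallyActs_of_le g
  -- At depth `N₁ + N₂`, the image prefix under `f` has length at least `N₂`.
  obtain ⟨w, hw, y, rfl⟩ := S.exists_cone (N₁ + N₂) x
  obtain ⟨q, τ, -, hq, hl⟩ := hf w (by omega)
  obtain ⟨r, σ, -, hr, -⟩ := hg q (by omega)
  have h : LocallyActs ((g * f : V m G) : Cantor m ≃ₜ Cantor m) w r (σ * τ) := hq.comp hr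
  rw [S.lift_cone hm h, S.lift_cone hm hq, S.lift_cone hm hr, map_mul, Equiv.Perm.mul_apply]

/-- The action of `V_m(G)` on a self-similar set. -/
noncomputable def liftHom (hm : 2 ≤ m) : V m G →* Equiv.Perm X where
  toFun f :=
    { toFun := S.lift hm f
      invFun := S.lift hm f⁻¹
      left_inv := fun x => by rw [← lift_mul, inv_mul_cancel, lift_one]
      right_inv := fun x => by rw [← lift_mul, mul_inv_cancel, lift_one] }
  map_one' := Equiv.ext (S.lift_one hm)
  map_mul' g f := Equiv.ext (S.lift_mul hm g f)

theorem liftHom_cone (hm : 2 ≤ m) {f : V m G} {w q : Word m} {τ : Equiv.Perm (Letter m)}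
    (h : LocallyActs (f : Cantor m ≃ₜ Cantor m) w q τ) (x : X) :
    S.liftHom hm f (S.cone w x) = S.cone q (S.act τ x) :=
  S.lift_cone hm h x

theorem eq_nil_of_forall_mem_range [Nonempty X] (hm : 2 ≤ m) {t : Word m}
    (h : ∀ x, ∃ y, x = S.cone t y) : t = [] := by
  have : Nontrivial (Letter m) := Fin.nontrivial_iff_two_le.2 hm
  obtain ⟨x₀⟩ := ‹Nonempty X›
  cases t with
  | nil => rfl
  | cons a t =>
    obtain ⟨b, hb⟩ := exists_ne a
    obtain ⟨y, hy⟩ := h (S.branch b x₀)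
    exact absurd (S.branch_inj hy).1 hb

theorem act_injective [Nonempty X] : Function.Injective S.act := by
  obtain ⟨x₀⟩ := ‹Nonempty X›
  intro τ σ h
  refine Equiv.ext fun c => ?_
  have := S.act_branch τ c x₀
  rw [h, act_branch] at this
  exact (S.branch_inj this).1.symm

/-- A trivial action identifies the cones of `w` and `q`, which forces `q = w`; then `τ` acts
trivially on X, so `τ = 1`. -/
theorem liftHom_injective [Nonempty X] (hm : 2 ≤ m) :
    Function.Injective (S.liftHom hm (G := G)) := by
  rw [injective_iff_map_eq_one]
  intro f hf
  obtain ⟨N, hN⟩ := exists_locallyActs f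
  obtain ⟨x₀⟩ := ‹Nonempty X›
  refine Subtype.ext (Homeomorph.ext fun ζ => ?_)
  obtain ⟨w, hw, u, rfl⟩ := exists_cat N ζ
  obtain ⟨q, τ, -, h⟩ := hN w hw
  have key : ∀ x, S.cone w x = S.cone q (S.act τ x) := fun x => by
    rw [← S.liftHom_cone hm h, hf, Equiv.Perm.one_apply]
  have hqw : q = w := by
    rcases le_total w.length q.length with hl | hl
    · obtain ⟨t, rfl⟩ := S.prefix_of_cone_eq (key x₀) hl
      rw [S.eq_nil_of_forall_mem_range hm (t := t) fun x =>
        ⟨S.act τ x, S.cone_injective w (by rw [← cone_append, key])⟩, List.append_nil]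
    · obtain ⟨t, rfl⟩ := S.prefix_of_cone_eq (key x₀).symm hl
      rw [S.eq_nil_of_forall_mem_range hm (t := t) fun x => ⟨(S.act τ).symm x,
        S.cone_injective q (by rw [← cone_append, key, Equiv.apply_symm_apply])⟩,
        List.append_nil]
  subst hqw
  have hτ : τ = 1 := S.act_injective <| by
    rw [map_one]
    exact Equiv.ext fun x => (S.cone_injective q (key x)).symm
  subst hτ
  exact h u

end SelfSimilar

/-! ### A self-similar clopen part of the n-adic Cantor space. -/

section Model

variable {m n : ℕ}

/-- The last letter of the alphabet `{0, …, n-1}`. -/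
def lastLetter (hmn : m < n) : Letter n := ⟨n - 1, by omega⟩

/-- A permutation of the first `m` letters, extended by the identity. -/
noncomputable abbrev extPerm (hmn : m < n) : Equiv.Perm (Letter m) →* Equiv.Perm (Letter n) :=
  Equiv.Perm.viaEmbeddingHom (Fin.castLEEmb hmn.le)

theorem extPerm_castLE (hmn : m < n) (τ : Equiv.Perm (Letter m)) (c : Letter m) :
    extPerm hmn τ (Fin.castLE hmn.le c) = Fin.castLE hmn.le (τ c) :=
  Equiv.Perm.viaEmbedding_apply τ (Fin.castLEEmb hmn.le) c

theorem extPerm_of_le (hmn : m < n) (τ : Equiv.Perm (Letter m)) {a : Letter n} (ha : m ≤ a.val) :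
    extPerm hmn τ a = a := by
  refine Equiv.Perm.viaEmbedding_apply_of_notMem τ (Fin.castLEEmb hmn.le) a ?_
  rintro ⟨c, rfl⟩
  exact absurd c.2 (not_lt.2 ha)

theorem extPerm_last (hmn : m < n) (τ : Equiv.Perm (Letter m)) :
    extPerm hmn τ (lastLetter hmn) = lastLetter hmn :=
  extPerm_of_le hmn τ (by simp only [lastLetter]; omega)

theorem extPerm_lt_iff (hmn : m < n) (τ : Equiv.Perm (Letter m)) (a : Letter n) :
    (extPerm hmn τ a).val < m ↔ a.val < m := by
  rcases lt_or_ge a.val m with h | h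
  · have : a = Fin.castLE hmn.le ⟨a, h⟩ := rfl
    rw [this, extPerm_castLE]
    exact iff_of_true (τ ⟨a, h⟩).2 h
  · rw [extPerm_of_le hmn τ h]

/-- The word obtained from a word of length at least two by inserting one letter, or none, in such
a way that it begins with `c`. -/
def branchWord (hmn : m < n) (c : Letter m) : Word n → Word n
  | b :: t :: r =>
    if b = Fin.castLE hmn.le c then
      if t.val < m ∧ t ≠ b then b :: t :: lastLetter hmn :: r else b :: t :: r
    else Fin.castLE hmn.le c :: b :: t :: r
  | W => W

/-- The word begins with one of the first `m` letters, followed by a letter other than the last. -/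
def ModelWord (hmn : m < n) : Word n → Prop
  | b :: t :: _ => b.val < m ∧ t ≠ lastLetter hmn
  | _ => False

theorem two_le_length_branchWord (hmn : m < n) (c : Letter m) {W : Word n} (hW : 2 ≤ W.length) :
    2 ≤ (branchWord hmn c W).length := by
  match W, hW with
  | b :: t :: r, _ =>
    simp only [branchWord]
    split_ifs <;> simp

theorem branchWord_append (hmn : m < n) (c : Letter m) {W : Word n} (hW : 2 ≤ W.length)
    (r : Word n) : branchWord hmn c (W ++ r) = branchWord hmn c W ++ r := by
  match W, hW with
  | b :: t :: _, _ =>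
    simp only [branchWord, List.cons_append]
    split_ifs <;> simp

theorem ModelWord.branchWord {hmn : m < n} {W : Word n} (hW : ModelWord hmn W) (c : Letter m) :
    ModelWord hmn (branchWord hmn c W) := by
  match W, hW with
  | b :: t :: r, ⟨hb, ht⟩ =>
    simp only [SymThompson.branchWord]
    split_ifs
    · exact ⟨hb, ht⟩
    · exact ⟨hb, ht⟩
    -- The second letter is now `b < m`, whereas the last letter is `n - 1 ≥ m`.
    · refine ⟨c.2, fun h => ?_⟩
      rw [h, lastLetter] at hb
      simp only at hb
      omega

theorem ModelWord.two_le_length {hmn : m < n} {W : Word n} (hW : ModelWord hmn W) :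
    2 ≤ W.length := by
  match W, hW with
  | _ :: _ :: _, _ => simp

/-- The tests in `branchWord` are invariant under an extended permutation, and the inserted letter
is fixed by it. -/
theorem map_branchWord (hmn : m < n) (τ : Equiv.Perm (Letter m)) (c : Letter m) (W : Word n) :
    (branchWord hmn c W).map (extPerm hmn τ) =
      branchWord hmn (τ c) (W.map (extPerm hmn τ)) := by
  match W with
  | [] => rfl
  | [a] => rfl
  | b :: t :: r =>
    have h₁ : extPerm hmn τ b = Fin.castLE hmn.le (τ c) ↔ b = Fin.castLE hmn.le c := by
      rw [← extPerm_castLE hmn, (extPerm hmn τ).apply_eq_iff_eq]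
    simp only [branchWord, List.map_cons, h₁, extPerm_lt_iff, ne_eq,
      (extPerm hmn τ).apply_eq_iff_eq]
    split_ifs
    · simp [extPerm_last]
    · simp
    · simp [extPerm_castLE]

/-- Every word in the model of length at least three has a preimage under a branch. -/
theorem ModelWord.exists_branchWord {hmn : m < n} {W : Word n} (hW : ModelWord hmn W)
    (hl : 3 ≤ W.length) : ∃ c W', ModelWord hmn W' ∧ W.length ≤ W'.length + 1 ∧
      SymThompson.branchWord hmn c W' = W := by
  match W, hW, hl with
  | x :: y :: z :: r, ⟨hx, hy⟩, _ =>
    have hc : x = Fin.castLE hmn.le ⟨x, hx⟩ := rfl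
    -- If this holds, `z` tells whether the last letter was inserted or `x` was prepended; if not,
    -- the branch left the word unchanged.
    by_cases h : y.val < m ∧ y ≠ x
    · by_cases hz : z = lastLetter hmn
      · refine ⟨⟨x, hx⟩, x :: y :: r, ⟨hx, hy⟩, by simp, ?_⟩
        simp only [SymThompson.branchWord]
        rw [if_pos hc, if_pos h, hz]
      · refine ⟨⟨x, hx⟩, y :: z :: r, ⟨h.1, hz⟩, by simp, ?_⟩
        simp only [SymThompson.branchWord]
        rw [if_neg (hc ▸ h.2), ← hc]
    · refine ⟨⟨x, hx⟩, x :: y :: z :: r, ⟨hx, hy⟩, by simp, ?_⟩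
      simp only [SymThompson.branchWord]
      rw [if_pos hc, if_neg h]

/-- The branch maps on infinite words. -/
def branchCantor (hmn : m < n) (c : Letter m) (ζ : Cantor n) : Cantor n :=
  cat (branchWord hmn c [ζ 0, ζ 1]) fun i => ζ (i + 2)

theorem branchCantor_cat (hmn : m < n) (c : Letter m) {W : Word n} (hW : 2 ≤ W.length)
    (u : Cantor n) : branchCantor hmn c (cat W u) = cat (branchWord hmn c W) u := by
  match W, hW with
  | b :: t :: r, _ =>
    have : b :: t :: r = [b, t] ++ r := rfl
    rw [this, branchWord_append hmn c (by simp), cat_append, cat_append]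
    rfl

/-- The clopen part of the Cantor space on which `V_m(G)` acts. -/
def Model (hmn : m < n) : Set (Cantor n) :=
  {ζ | (ζ 0).val < m ∧ ζ 1 ≠ lastLetter hmn}

theorem cat_mem_model_iff (hmn : m < n) {W : Word n} (hW : 2 ≤ W.length) (u : Cantor n) :
    cat W u ∈ Model hmn ↔ ModelWord hmn W := by
  match W, hW with
  | _ :: _ :: _, _ => exact Iff.rfl

theorem branchCantor_mem (hmn : m < n) (c : Letter m) {ζ : Cantor n} (h : ζ ∈ Model hmn) :
    branchCantor hmn c ζ ∈ Model hmn := by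
  obtain ⟨W, hW, u, rfl⟩ := exists_cat 2 ζ
  rw [branchCantor_cat hmn c hW.ge,
    cat_mem_model_iff hmn (two_le_length_branchWord hmn c hW.ge)]
  exact ((cat_mem_model_iff hmn hW.ge u).1 h).branchWord c

theorem branchCantor_zero (hmn : m < n) (c : Letter m) (ζ : Cantor n) :
    branchCantor hmn c ζ 0 = Fin.castLE hmn.le c := by
  simp only [branchCantor, branchWord]
  split_ifs with h₁ h₂
  · exact h₁
  · exact h₁
  · rfl

theorem branchCantor_injOn (hmn : m < n) (c : Letter m) :
    Set.InjOn (branchCantor hmn c) (Model hmn) := by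
  intro ζ hζ ξ hξ h
  obtain ⟨W, hW, u, rfl⟩ := exists_cat 2 ζ
  obtain ⟨Z, hZ, z, rfl⟩ := exists_cat 2 ξ
  match W, Z, hW, hZ with
  | [b, t], [b', t'], _, _ =>
    rw [branchCantor_cat hmn c (by simp), branchCantor_cat hmn c (by simp)] at h
    have ht : t ≠ lastLetter hmn := hζ.2
    have ht' : t' ≠ lastLetter hmn := hξ.2
    have hb : b.val < m := hζ.1
    have hb' : b'.val < m := hξ.1
    simp only [branchWord] at h
    -- The mixed cases contradict each other: an inserted last letter in third place cannot be the
    -- second letter of a word of the model, and the unchanged words differ from the others in their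
    -- second letter.
    split_ifs at h with h₁ h₂ h₃ h₄ h₃ h₄ h₃ h₄
    · obtain ⟨e₀, e⟩ := cat_cons_inj h
      obtain ⟨e₁, e₂⟩ := cat_cons_inj e
      subst e₀ e₁
      rw [show u = z from (cat_cons_inj e₂).2]
    · obtain ⟨e₀, e⟩ := cat_cons_inj h
      obtain ⟨e₁, e₂⟩ := cat_cons_inj e
      subst e₀ e₁
      exact absurd h₂ h₄
    · exact absurd (cat_cons_inj (cat_cons_inj (cat_cons_inj h).2).2).1.symm ht'
    · obtain ⟨e₀, e⟩ := cat_cons_inj h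
      obtain ⟨e₁, e₂⟩ := cat_cons_inj e
      subst e₀ e₁
      exact absurd h₄ h₂
    · exact h
    · obtain rfl := (cat_cons_inj (cat_cons_inj h).2).1
      exact absurd ⟨hb', fun e => h₃ (e.trans h₁)⟩ h₂
    · exact absurd (cat_cons_inj (cat_cons_inj (cat_cons_inj h).2).2).1 ht
    · obtain rfl := (cat_cons_inj (cat_cons_inj h).2).1
      exact absurd ⟨hb, fun e => h₁ (e.trans h₃)⟩ h₄
    · exact (cat_cons_inj h).2

theorem exists_branchCantor (hmn : m < n) {ζ : Cantor n} (h : ζ ∈ Model hmn) :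
    ∃ c, ∃ ξ ∈ Model hmn, branchCantor hmn c ξ = ζ := by
  obtain ⟨W, hW, u, rfl⟩ := exists_cat 3 ζ
  obtain ⟨c, W', hW', -, rfl⟩ :=
    ((cat_mem_model_iff hmn (by omega) u).1 h).exists_branchWord hW.ge
  exact ⟨c, cat W' u, (cat_mem_model_iff hmn hW'.two_le_length u).2 hW',
    branchCantor_cat hmn c hW'.two_le_length u⟩

theorem comp_branchCantor (hmn : m < n) (τ : Equiv.Perm (Letter m)) (c : Letter m)
    (ζ : Cantor n) :
    extPerm hmn τ ∘ branchCantor hmn c ζ = branchCantor hmn (τ c) (extPerm hmn τ ∘ ζ) := by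
  obtain ⟨W, hW, u, rfl⟩ := exists_cat 2 ζ
  rw [branchCantor_cat hmn c hW.ge, comp_cat, comp_cat,
    branchCantor_cat hmn _ (by simp [hW]), map_branchWord]

theorem extPerm_comp_mem (hmn : m < n) (τ : Equiv.Perm (Letter m)) {ζ : Cantor n}
    (h : ζ ∈ Model hmn) : extPerm hmn τ ∘ ζ ∈ Model hmn := by
  refine ⟨(extPerm_lt_iff hmn τ _).2 h.1, fun e => h.2 ?_⟩
  rw [← extPerm_last hmn τ] at e
  exact (extPerm hmn τ).injective e

/-- The action of `Sym(m)` on the model, letter by letter. -/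
noncomputable def modelAct (hmn : m < n) :
    Equiv.Perm (Letter m) →* Function.End (Model hmn) where
  toFun τ ζ := ⟨extPerm hmn τ ∘ ζ.1, extPerm_comp_mem hmn τ ζ.2⟩
  map_one' := by
    funext ζ
    apply Subtype.ext
    change extPerm hmn 1 ∘ ζ.1 = ζ.1
    rw [map_one]
    rfl
  map_mul' σ τ := by
    funext ζ
    apply Subtype.ext
    change extPerm hmn (σ * τ) ∘ ζ.1 = _
    rw [map_mul]
    rfl

/-- The model as a self-similar set. -/
noncomputable def modelSelfSimilar (hmn : m < n) : SelfSimilar m (Model hmn) where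
  branch c ζ := ⟨branchCantor hmn c ζ.1, branchCantor_mem hmn c ζ.2⟩
  act := (modelAct hmn).toHomPerm
  bijective_branch := by
    constructor
    · rintro ⟨c, ζ⟩ ⟨d, ξ⟩ h
      have h' : branchCantor hmn c ζ.1 = branchCantor hmn d ξ.1 := congrArg Subtype.val h
      have hcd : c = d := by
        have := congrFun h' 0
        rw [branchCantor_zero, branchCantor_zero] at this
        exact Fin.castLE_injective _ this
      subst hcd
      rw [Subtype.ext (branchCantor_injOn hmn c ζ.2 ξ.2 h')]
    · rintro ⟨ζ, hζ⟩
      obtain ⟨c, ξ, hξ, rfl⟩ := exists_branchCantor hmn hζ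
      exact ⟨(c, ⟨ξ, hξ⟩), rfl⟩
  act_branch τ c ζ := Subtype.ext (comp_branchCantor hmn τ c ζ.1)

/-- Cones alter only the prefix and leave the tail `u` as it is; this is why the induced maps are
prefix replacements. -/
theorem cone_val (hmn : m < n) (w : Word m) {W : Word n} (hW : 2 ≤ W.length) (u : Cantor n)
    (ζ : Model hmn) (hζ : ζ.1 = cat W u) :
    ((modelSelfSimilar hmn).cone w ζ).1 = cat (w.foldr (branchWord hmn) W) u ∧
      2 ≤ (w.foldr (branchWord hmn) W).length := by
  induction w with
  | nil => exact ⟨hζ, hW⟩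
  | cons c w ih =>
    refine ⟨?_, two_le_length_branchWord hmn c ih.2⟩
    change branchCantor hmn c ((modelSelfSimilar hmn).cone w ζ).1 = _
    rw [ih.1, branchCantor_cat hmn c ih.2]
    rfl

/-- Undoing a branch costs at most one letter, so `N + 2` letters leave the two that membership in
the model needs. -/
theorem ModelWord.exists_foldr {hmn : m < n} (N : ℕ) {W : Word n} (hW : ModelWord hmn W)
    (hl : N + 2 ≤ W.length) : ∃ w : Word m, w.length = N ∧ ∃ W', ModelWord hmn W' ∧
      w.foldr (SymThompson.branchWord hmn) W' = W := by
  induction N generalizing W with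
  | zero => exact ⟨[], rfl, W, hW, rfl⟩
  | succ N ih =>
    obtain ⟨c, W₁, hW₁, hl₁, rfl⟩ := hW.exists_branchWord (by omega)
    obtain ⟨w, hw, W', hW', rfl⟩ := ih hW₁ (by omega)
    exact ⟨c :: w, by simp [hw], W', hW', rfl⟩

/-! ### The embedding and its fixed points. -/

variable {G : Subgroup (Equiv.Perm (Letter m))}

open Classical in
/-- The action of `V_m(G)` on the whole Cantor space, trivial outside of the model. -/
noncomputable def cantorHom (hm : 2 ≤ m) (hmn : m < n) : V m G →* Equiv.Perm (Cantor n) :=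
  (Equiv.Perm.ofSubtype (p := (· ∈ Model hmn))).comp ((modelSelfSimilar hmn).liftHom hm)

theorem cantorHom_of_notMem (hm : 2 ≤ m) (hmn : m < n) (f : V m G) {ζ : Cantor n}
    (h : ζ ∉ Model hmn) : cantorHom hm hmn f ζ = ζ := by
  classical
  exact Equiv.Perm.ofSubtype_apply_of_not_mem _ h

theorem cantorHom_coe (hm : 2 ≤ m) (hmn : m < n) (f : V m G) (ζ : Model hmn) :
    cantorHom hm hmn f ζ = (modelSelfSimilar hmn).liftHom hm f ζ := by
  classical
  exact Equiv.Perm.ofSubtype_apply_coe _ _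

theorem cantorHom_injective (hm : 2 ≤ m) (hmn : m < n) :
    Function.Injective (cantorHom hm hmn (G := G)) := by
  classical
  have : Nonempty (Model hmn) :=
    ⟨⟨fun _ => ⟨0, by omega⟩, by simp; omega, by simp [lastLetter, Fin.ext_iff]; omega⟩⟩
  exact Equiv.Perm.ofSubtype_injective.comp ((modelSelfSimilar hmn).liftHom_injective hm)

theorem cantorHom_locallyActs (hm : 2 ≤ m) (hmn : m < n) (f : V m G) : ∃ N : ℕ,
    ∀ W : Word n, W.length = N → ∃ Q, ∃ τ ∈ extGroup hmn.le G,
      LocallyActs (cantorHom hm hmn f) W Q τ := by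
  obtain ⟨N, hN⟩ := exists_locallyActs f
  refine ⟨N + 2, fun W hl => ?_⟩
  by_cases hW : ModelWord hmn W
  · obtain ⟨w, hw, W', hW', rfl⟩ := hW.exists_foldr N hl.ge
    obtain ⟨q, τ, hτ, h⟩ := hN w hw
    refine ⟨q.foldr (branchWord hmn) (W'.map (extPerm hmn τ)), extPerm hmn τ,
      Subgroup.mem_map_of_mem _ hτ, fun u => ?_⟩
    have hl' := hW'.two_le_length
    let ζ : Model hmn := ⟨cat W' u, (cat_mem_model_iff hmn hl' u).2 hW'⟩
    rw [← (cone_val hmn w hl' u ζ rfl).1, cantorHom_coe,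
      (modelSelfSimilar hmn).liftHom_cone hm h]
    exact (cone_val hmn q (by simpa using hl') _ _ (comp_cat _ W' u)).1
  -- The length of `W` is at least two, so its cylinder misses the model entirely.
  · exact ⟨W, 1, one_mem _, fun u =>
      cantorHom_of_notMem hm hmn f (mt (cat_mem_model_iff hmn (by omega) u).1 hW)⟩

theorem continuous_cantorHom (hm : 2 ≤ m) (hmn : m < n) (f : V m G) :
    Continuous (cantorHom hm hmn f) := by
  obtain ⟨N, hN⟩ := cantorHom_locallyActs hm hmn f
  refine continuous_of_locallyActs (N := N) fun W hW => ?_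
  obtain ⟨Q, τ, -, h⟩ := hN W hW
  exact ⟨Q, τ, h⟩

/-- The embedding of `V_m(G)` into `V_n(G_ext)` for `m < n`. -/
noncomputable def embedding (hm : 2 ≤ m) (hmn : m < n) : V m G →* V n (extGroup hmn.le G) where
  toFun f := ⟨{ cantorHom hm hmn f with
      continuous_toFun := continuous_cantorHom hm hmn f
      continuous_invFun := by
        have := continuous_cantorHom hm hmn f⁻¹
        rwa [map_inv] at this },
    (describes_iff _).2 (cantorHom_locallyActs hm hmn f)⟩
  map_one' := Subtype.ext (Homeomorph.ext fun ζ =>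
    congrArg (fun e : Equiv.Perm (Cantor n) => e ζ) (map_one (cantorHom hm hmn (G := G))))
  map_mul' g f := Subtype.ext (Homeomorph.ext fun ζ =>
    congrArg (fun e : Equiv.Perm (Cantor n) => e ζ) (map_mul (cantorHom hm hmn) g f))

theorem embedding_apply (hm : 2 ≤ m) (hmn : m < n) (f : V m G) (ζ : Cantor n) :
    (embedding hm hmn f : Cantor n ≃ₜ Cantor n) ζ = cantorHom hm hmn f ζ := rfl

theorem embedding_injective (hm : 2 ≤ m) (hmn : m < n) :
    Function.Injective (embedding hm hmn (G := G)) := by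
  intro g f h
  refine cantorHom_injective hm hmn (Equiv.ext fun ζ => ?_)
  rw [← embedding_apply, h, embedding_apply]

/-- The group `V_m(G)` has no global fixed point. -/
theorem exists_apply_ne (hm : 2 ≤ m) (ζ : Cantor m) :
    ∃ g : V m G, (g : Cantor m ≃ₜ Cantor m) ζ ≠ ζ := by
  have : Nontrivial (Letter m) := Fin.nontrivial_iff_two_le.2 hm
  obtain ⟨b, hb⟩ := exists_ne (ζ 0)
  let π : Equiv.Perm (Letter m) := Equiv.swap (ζ 0) b
  -- Only the first letter is permuted; tails are untouched, so the map lies in V_m(G) for every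
  -- `G`.
  let e : ℕ → (Letter m ≃ₜ Letter m) := fun i =>
    Nat.casesOn i π.toHomeomorphOfDiscrete fun _ => Homeomorph.refl _
  refine ⟨⟨Homeomorph.piCongrRight e, (describes_iff _).2 ⟨1, fun w hw => ?_⟩⟩, fun h => hb ?_⟩
  · obtain ⟨c, rfl⟩ := List.length_eq_one_iff.1 hw
    refine ⟨[π c], 1, one_mem _, fun u => funext fun i => ?_⟩
    cases i <;> rfl
  · have h₀ : π (ζ 0) = ζ 0 := congrFun h 0
    rwa [Equiv.swap_apply_left] at h₀

end Model

end SymThompson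

theorem theorem1p2 (m n k : ℕ) (hm : 2 ≤ m) (hk : 1 ≤ k) (hn : n = k * (m - 1) + m)
    (G : Subgroup (Equiv.Perm (SymThompson.Letter m))) :
    ∃ φ : SymThompson.V m G →*
        SymThompson.V n (SymThompson.extGroup (hn.symm ▸ Nat.le_add_left m (k * (m - 1)) : m ≤ n) G),
      Function.Injective φ ∧
      ¬ ∃ h : SymThompson.Cantor m ≃ₜ SymThompson.Cantor n,
        ∀ (g : SymThompson.V m G) (ζ : SymThompson.Cantor m),
          (φ g : SymThompson.Cantor n ≃ₜ SymThompson.Cantor n) (h ζ) =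
            h ((g : SymThompson.Cantor m ≃ₜ SymThompson.Cantor m) ζ) := by
  have hmn : m < n := by
    have : 0 < k * (m - 1) := Nat.mul_pos hk (by omega)
    omega
  refine ⟨SymThompson.embedding hm hmn, SymThompson.embedding_injective hm hmn, ?_⟩
  rintro ⟨h, hh⟩
  -- This point lies outside the model, so a conjugacy would pull it back to a global fixed point of
  -- V_m(G).
  let z : SymThompson.Cantor n := fun _ => SymThompson.lastLetter hmn
  obtain ⟨g, hg⟩ := SymThompson.exists_apply_ne (G := G) hm (h.symm z)
  refine hg (h.injective ?_)
  rw [← hh, Homeomorph.apply_symm_apply]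
  exact SymThompson.cantorHom_of_notMem hm hmn g fun hz => hz.2 rfl
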